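/- **Setting.** Instances live in a measurable space $\mathcal X$, labels in $\{-1,1\}$. Let $P$ be the clean law on $\mathcal X\times\{-1,1\}$ and $Q=(1-\eta)P+\eta N$ its contamination by a law $N$ of noisy points ($\eta\in[0,1]$), where $P$ and $Q$ have the same conditional law $P(y\mid x)$ of the label. A training sample $(x_1,y_1),\dots,(x_n,y_n)$ is drawn i.i.d. from $Q$ ($n\ge1$); $\mathcal D_o\subseteq\{1,\dots,n\}$ is the set of indices of the noisy points (those drawn from $N$), $\mathcal S$ its complement (the clean points), and $n_o=|\mathcal D_o|$. Independently, test instances $x'_1,\dots,x'_{n'}$ are drawn i.i.d. from the $x$-marginal of $P$ ($n'\ge1$). Put $c_i=1$ for $i\in\mathcal S$ and $c_i=0$ for $i\in\mathcal D_o$. *Simple-Complex problem.* Let $\mathcal H,\mathcal H_o$ be real Hilbert spaces, $\varphi:\mathcal X\to\mathcal H$, $\psi:\mathcal X\to\mathcal H_o$ feature maps and $\lambda,\lambda_o$ real parameters. The problem is $$\min_{w\in\mathcal H,\;w_o\in\mathcal H_o}\ \sum_{i=1}^n (1-y_i\langle w_o,\psi(x_i)\rangle)_+(1-y_i\langle w,\varphi(x_i)\rangle)_+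 +\tfrac{\lambda}{2}\|w\|^2+\tfrac{\lambda_o}{2}\|w_o\|^2$$ subject to $\sum_i|\langle w_o,\psi(x_i)\rangle|\le n_o$ and $|\langle w_o,\psi(x_i)\rangle|\le1$ for all $i$. *Loss class.* $\mathcal G=\{l(\cdot,\cdot,\theta)\}_{\theta}$ with $l(x,y,\theta)=\langle\Upsilon(x,y),\Lambda_\theta\rangle$ in a Hilbert space, $\Upsilon$ measurable, $\|\Upsilon(x,y)\|\le R$, $\|\Lambda_\theta\|\le C$; the conditional expected loss is $\mathbf E[l(x,y,\theta)\mid x]=\langle\Phi(x),\Xi_\theta\rangle$ in a Hilbert space, with $\|\Xi_\theta\|\le C$; and $B$ is such that $|l(x,y,\theta)|\le CB$ for all $x,y,\theta$ (for instance any $B$ with $\|\Upsilon(x,y)\|\le B$). *Conditions.* Let $\epsilon,\epsilon_1,\epsilon_2$ be real numbers. (a) $\big\|\frac1n\sum_i c_i\Phi(x_i)-\frac1{n'}\sum_j\Phi(x'_j)\big\|\le\epsilon$. (b) For an optimal solution $(w^*,w_o^*)$ of the Simple-Complex problem: $|\psi(x_i)^{\mathsf T}w_o^*|\le\epsilon_1$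 for all $i\in\mathcal S$, and $|\psi(x_i)^{\mathsf T}w_o^*|\ge1-\epsilon_2$ and $y_i\,\psi(x_i)^{\mathsf T}w_o^*\ge0$ for all $i\in\mathcal D_o$. **Theorem 5.** Let $0<\delta<1$. With probability at least $1-\delta$, if (a) holds, then every optimal solution $(w^*,w_o^*)$ that satisfies (b) also satisfies $$\sup_{l(\cdot,\cdot,\theta)\in\mathcal G}\Big|\frac1n\sum_{i=1}^n l^*_{w_o,i}\,l(x_i,y_i,\theta)-\mathbf E_{Y'\mid X'}\Big[\frac1{n'}\sum_{j=1}^{n'}l(x'_j,y'_j,\theta)\Big]\Big|\le\frac{\big(1+\sqrt{(-\log\delta)/2}\big)\,2CR}{\sqrt M}+C\epsilon_0,$$ where $l^*_{w_o,i}=1-y_i\psi(x_i)^{\mathsf T}w_o^*$, $M=n^2/\sum_ic_i^2$ (with $1/\sqrt M=0$ if all points are noisy), and $\epsilon_0=\epsilon+\frac1n\sum_{i=1}^n\big(\epsilon_1B+\frac{n_o}{n}(1-\epsilon_1)B\big)$. The probability statement holds both (i) conditionally on the instances: for every fixed $x_1,\dots,x_n$, $x'_1,\dots,x'_{n'}$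 and $\mathcal D_o$ satisfying (a), with the $y_i$ drawn independently from $P(\cdot\mid x_i)$; and (ii) over the joint draw of the flagged training sample and the test instances. -/

import Mathlib

open MeasureTheory ProbabilityTheory
open scoped NNReal ENNReal

noncomputable section

namespace SimpleComplex

/-- The class label in `{-1, 1}` encoded by a Boolean. -/
def labelSign (b : Bool) : ℝ := if b then 1 else -1

/-- The hinge loss `(1 - u)₊`. -/
def hinge (u : ℝ) : ℝ := max 0 (1 - u)

section Classifier

variable {𝒳 H Ho : Type*}
  [NormedAddCommGroup H] [InnerProductSpace ℝ H]
  [NormedAddCommGroup Ho] [InnerProductSpace ℝ Ho] {n : ℕ}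

/-- Objective of the (non-convex) Simple-Complex problem for the labelled data `(xᵢ, yᵢ)`, with
`f(x) = ⟪w, φ x⟫` and `f_o(x) = ⟪w_o, ψ x⟫`:
`∑ᵢ (1 - yᵢ f_o(xᵢ))₊ (1 - yᵢ f(xᵢ))₊ + lam/2 ‖w‖² + lamo/2 ‖w_o‖²`. -/
def objective (φ : 𝒳 → H) (ψ : 𝒳 → Ho) (lam lamo : ℝ) (x : Fin n → 𝒳) (y : Fin n → Bool)
    (p : H × Ho) : ℝ :=
  (∑ i, hinge (labelSign (y i) * inner ℝ p.2 (ψ (x i)))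
      * hinge (labelSign (y i) * inner ℝ p.1 (φ (x i))))
    + lam / 2 * ‖p.1‖ ^ 2 + lamo / 2 * ‖p.2‖ ^ 2

/-- Constraints of the Simple-Complex problem: `∑ᵢ |f_o(xᵢ)| ≤ n_o` and `|f_o(xᵢ)| ≤ 1`. -/
def feasible (H : Type*) (ψ : 𝒳 → Ho) (no : ℕ) (x : Fin n → 𝒳) : Set (H × Ho) :=
  {p | ∑ i, |inner ℝ p.2 (ψ (x i))| ≤ (no : ℝ) ∧ ∀ i, |inner ℝ p.2 (ψ (x i))| ≤ 1}

/-- `p = (w*, w_o*)` is a global minimizer of the Simple-Complex problem. -/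
def IsOptimal (φ : 𝒳 → H) (ψ : 𝒳 → Ho) (lam lamo : ℝ) (no : ℕ) (x : Fin n → 𝒳)
    (y : Fin n → Bool) (p : H × Ho) : Prop :=
  p ∈ feasible H ψ no x ∧ IsMinOn (objective φ ψ lam lamo x y) (feasible H ψ no x) p

/-- The function `f_o` given by `w_o` separates clean from noisy training points: `|f_o| ≤ ε₁` on
clean points, `|f_o| ≥ 1 - ε₂` on noisy points, and there `yᵢ f_o(xᵢ) ≥ 0`, the sign convention
under which the hinge `1 - yᵢ f_o(xᵢ)` is a surrogate of the 0-1 coefficient. -/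
def Discriminates (ψ : 𝒳 → Ho) (ε₁ ε₂ : ℝ) (Do : Finset (Fin n)) (x : Fin n → 𝒳)
    (y : Fin n → Bool) (wo : Ho) : Prop :=
  (∀ i, i ∉ Do → |inner ℝ (ψ (x i)) wo| ≤ ε₁) ∧
  (∀ i ∈ Do, 1 - ε₂ ≤ |inner ℝ (ψ (x i)) wo|) ∧
  (∀ i ∈ Do, 0 ≤ labelSign (y i) * inner ℝ (ψ (x i)) wo)

/-- The weight `1 - yᵢ ψ(xᵢ)ᵀ w_o` of the `i`-th training loss. -/
def weight (ψ : 𝒳 → Ho) (x : Fin n → 𝒳) (y : Fin n → Bool) (wo : Ho) (i : Fin n) : ℝ :=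
  1 - labelSign (y i) * inner ℝ (ψ (x i)) wo

end Classifier

section Risk

variable {𝒳 Θ : Type*} {n n' : ℕ}

/-- The ideal coefficient `cᵢ` of the `i`-th training loss: `1` on clean, `0` on noisy points. -/
def idealCoeff (Do : Finset (Fin n)) (i : Fin n) : ℝ := if i ∈ Do then 0 else 1

/-- Effective sample size `n² / ‖c‖²` of the ideal coefficients. If every point is noisy, this is
`0` by the convention on division, and then also `a / √M = 0`, the value for `M = ∞`. -/
def effSampleSize (Do : Finset (Fin n)) : ℝ := (n : ℝ) ^ 2 / ∑ i, idealCoeff Do i ^ 2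

/-- Distance in feature space between the `c`-weighted mean of the training instances and the mean
of the test instances. -/
def meanDiscrepancy {F : Type*} [NormedAddCommGroup F] [InnerProductSpace ℝ F] (Φ : 𝒳 → F)
    (Do : Finset (Fin n)) (x : Fin n → 𝒳) (x' : Fin n' → 𝒳) : ℝ :=
  ‖(n : ℝ)⁻¹ • ∑ i, idealCoeff Do i • Φ (x i) - (n' : ℝ)⁻¹ • ∑ j, Φ (x' j)‖

/-- The weighted empirical risk `1/n ∑ᵢ βᵢ l(xᵢ, yᵢ, θ)`. -/
def weightedRisk (l : 𝒳 → Bool → Θ → ℝ) (β : Fin n → ℝ) (x : Fin n → 𝒳) (y : Fin n → Bool)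
    (θ : Θ) : ℝ :=
  (n : ℝ)⁻¹ * ∑ i, β i * l (x i) (y i) θ

/-- The expected clean empirical risk `E_{Y'|X'} [1/n' ∑ⱼ l(x'ⱼ, y'ⱼ, θ)]`: the labels `y'ⱼ` are
independent, with law `κ (x'ⱼ) = P(y | x'ⱼ)`. -/
def expectedRisk [MeasurableSpace 𝒳] (κ : Kernel 𝒳 Bool) (l : 𝒳 → Bool → Θ → ℝ)
    (x' : Fin n' → 𝒳) (θ : Θ) : ℝ :=
  ∫ y' : Fin n' → Bool, (n' : ℝ)⁻¹ * ∑ j, l (x' j) (y' j) θ ∂(Measure.pi fun j => κ (x' j))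

/-- `ε₀ = ε + 1/n ∑ᵢ (ε₁ B + n_o/n (1 - ε₁) B)`. -/
def epsZero (ε ε₁ B : ℝ) (Do : Finset (Fin n)) : ℝ :=
  ε + (n : ℝ)⁻¹ * ∑ _i : Fin n, (ε₁ * B + (Do.card : ℝ) / n * (1 - ε₁) * B)

/-- `(1 + √(-log δ / 2)) 2CR / √M + C ε₀`. -/
def riskBound (C R B δ ε ε₁ : ℝ) (Do : Finset (Fin n)) : ℝ :=
  (1 + Real.sqrt (-Real.log δ / 2)) * (2 * C * R) / Real.sqrt (effSampleSize Do)
    + C * epsZero ε ε₁ B Do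

variable {H Ho : Type*} [MeasurableSpace 𝒳]
  [NormedAddCommGroup H] [InnerProductSpace ℝ H]
  [NormedAddCommGroup Ho] [InnerProductSpace ℝ Ho]

/-- Every optimal `w_o*` of the Simple-Complex problem that discriminates the noisy points
`Do` from the clean ones satisfies the risk bound, uniformly over the loss class. -/
def BoundHolds (κ : Kernel 𝒳 Bool) (l : 𝒳 → Bool → Θ → ℝ) (φ : 𝒳 → H) (ψ : 𝒳 → Ho)
    (lam lamo ε₁ ε₂ C R B δ ε : ℝ) (Do : Finset (Fin n)) (x : Fin n → 𝒳) (y : Fin n → Bool)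
    (x' : Fin n' → 𝒳) : Prop :=
  ∀ (w : H) (wo : Ho), IsOptimal φ ψ lam lamo Do.card x y (w, wo) →
    Discriminates ψ ε₁ ε₂ Do x y wo →
    ∀ θ, |weightedRisk l (weight ψ x y wo) x y θ - expectedRisk κ l x' θ|
      ≤ riskBound C R B δ ε ε₁ Do

end Risk

section Sampling

variable {𝒳 : Type*} [MeasurableSpace 𝒳]

/-- The contaminated law: with probability `1 - η` a draw of the clean law `P`, with
probability `η` a draw of the law `N` of noisy points. -/
def contaminatedLaw (η : ℝ≥0) (P N : Measure (𝒳 × Bool)) : Measure (𝒳 × Bool) :=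
  (1 - η) • P + η • N

/-- The same draw as in `contaminatedLaw`, recorded with the flag telling whether it is noisy. -/
def flaggedLaw (η : ℝ≥0) (P N : Measure (𝒳 × Bool)) : Measure (Bool × (𝒳 × Bool)) :=
  (1 - η) • P.map (Prod.mk false) + η • N.map (Prod.mk true)

/-- Forgetting the flag gives a draw of the contaminated law. -/
theorem flaggedLaw_snd (η : ℝ≥0) (P N : Measure (𝒳 × Bool)) :
    (flaggedLaw η P N).snd = contaminatedLaw η P N := by
  have h : ∀ (b : Bool) (M : Measure (𝒳 × Bool)), (M.map (Prod.mk b)).map Prod.snd = M := by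
    intro b M
    rw [Measure.map_map measurable_snd measurable_prodMk_left]
    exact Measure.map_id
  rw [flaggedLaw, contaminatedLaw, Measure.snd, Measure.map_add _ _ measurable_snd,
    Measure.map_smul, Measure.map_smul, h, h]

/-- The set `D_o` of indices of the noisy points of a flagged sample. -/
def noisySet {n : ℕ} (s : Fin n → Bool × (𝒳 × Bool)) : Finset (Fin n) :=
  Finset.univ.filter fun i => (s i).1 = true

end Sampling

end SimpleComplex

end

open SimpleComplex

/-! The training labels enter only through one vector, `featureDeviation`: the `c`-weighted mean of
the features minus its conditional mean given the instances. Uniformity over `θ` and over solutions,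
which depend on the labels, is therefore free.

Replacing weights by ideal coefficients is deterministic. Feasibility and the sign condition put the
weight of a noisy point in `[0, 1]`, and a clean weight is within `ε₁` of `1`; this costs `C (ε₀ -
ε)`. The risk with ideal coefficients differs from the expected test risk by `⟪featureDeviation, Λ
θ⟫` plus the pairing of the mean discrepancy with `Ξ θ`, so Cauchy-Schwarz gives `C
‖featureDeviation‖ + C ε`.

Given the instances, `featureDeviation` is a sum of independent centred vectors of diameters at most
`2R cᵢ / n`, whose squares sum to `(2R)² / M`. A second moment bound controls the mean of its norm
and McDiarmid's inequality the fluctuation (`measure_pi_norm_sum_gt_le`). The joint statement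
integrates this conditional bound (`measure_pi_flaggedLaw_le`), since noisy labels also have
conditional law `κ`. -/

/-! ### Concentration for independent variables on a finite alphabet. -/

section FiniteProduct

variable {α : Type*} [Finite α] [MeasurableSpace α] [MeasurableSingletonClass α]

theorem integral_pi_fin_succ {G : Type*} [NormedAddCommGroup G] [NormedSpace ℝ G] {n : ℕ}
    (μ : Fin (n + 1) → Measure α) [∀ i, IsProbabilityMeasure (μ i)] (f : (Fin (n + 1) → α) → G) :
    ∫ y, f y ∂(Measure.pi μ)
      = ∫ b, ∫ y, f (Fin.cons b y) ∂(Measure.pi fun i => μ i.succ) ∂(μ 0) := by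
  rw [← ((measurePreserving_piFinSuccAbove μ 0).symm).integral_comp']
  have h := integral_prod (μ := μ 0) (ν := Measure.pi fun i => μ (Fin.succAbove 0 i))
    (fun p => f (Fin.cons p.1 p.2)) (Integrable.of_finite)
  simpa [MeasurableEquiv.piFinSuccAbove_symm_apply, Fin.insertNthEquiv] using h

/-- McDiarmid's bounded differences inequality on a finite alphabet, as a bound on the moment
generating function. -/
theorem hasSubgaussianMGF_of_bounded_differences {n : ℕ} (μ : Fin n → Measure α)
    [∀ i, IsProbabilityMeasure (μ i)] (f : (Fin n → α) → ℝ) (d : Fin n → ℝ)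
    (hf : ∀ i y a, |f y - f (Function.update y i a)| ≤ d i) :
    HasSubgaussianMGF (fun y => f y - ∫ z, f z ∂(Measure.pi μ)) (∑ i, (‖d i‖₊ / 2) ^ 2)
      (Measure.pi μ) := by
  refine ⟨fun t => Integrable.of_finite, ?_⟩
  induction n with
  | zero =>
    intro t
    have h : ∀ y : Fin 0 → α, f y - ∫ z, f z ∂(Measure.pi μ) = 0 := by
      intro y
      rw [integral_congr_ae (g := fun _ => f y) (.of_forall fun z => by
        rw [Subsingleton.elim z y])]
      simp
    simp [h, mgf]
  | succ n ih =>
    intro t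
    set ν : Measure (Fin n → α) := Measure.pi fun i => μ i.succ with hν
    -- The conditional mean given the first coordinate: `g - ∫ g` is the first martingale increment,
    -- and the induction hypothesis handles the rest.
    set g : α → ℝ := fun b => ∫ y, f (Fin.cons b y) ∂ν with hg
    have hmean : ∫ z, f z ∂(Measure.pi μ) = ∫ b, g b ∂(μ 0) := integral_pi_fin_succ μ f
    have hnonempty : Nonempty α := nonempty_of_isProbabilityMeasure (μ 0)
    have hgd : ∀ a b, g b ≤ g a + d 0 := by
      intro a b
      rw [← sub_le_iff_le_add', hg, ← integral_sub .of_finite .of_finite]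
      refine (integral_mono (g := fun _ => d 0) .of_finite .of_finite fun y => ?_).trans_eq
        (by simp)
      have := hf 0 (Fin.cons b y) a
      rw [Fin.update_cons_zero] at this
      exact (le_abs_self _).trans this
    -- Hoeffding's lemma needs an interval; starting it at the minimum of `g` keeps its length at `d
    -- 0`.
    obtain ⟨a, ha⟩ := Finite.exists_min g
    have hoeffding := hasSubgaussianMGF_of_mem_Icc (μ := μ 0) (X := g) (a := g a) (b := g a + d 0)
      (Measurable.of_discrete.aemeasurable) (.of_forall fun b => ⟨ha b, hgd a b⟩)
    rw [add_sub_cancel_left] at hoeffding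
    have hinner : ∀ b, mgf (fun y => f (Fin.cons b y) - g b) ν t
        ≤ Real.exp (((∑ i : Fin n, (‖d i.succ‖₊ / 2) ^ 2 : ℝ≥0) : ℝ) * t ^ 2 / 2) := by
      intro b
      refine ih (fun i => μ i.succ) (fun y => f (Fin.cons b y)) (fun i => d i.succ) ?_ t
      intro i y c
      have := hf i.succ (Fin.cons b y) c
      rwa [← Fin.cons_update] at this
    calc mgf (fun y => f y - ∫ z, f z ∂(Measure.pi μ)) (Measure.pi μ) t
        = ∫ b, Real.exp (t * (g b - ∫ b, g b ∂(μ 0)))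
            * mgf (fun y => f (Fin.cons b y) - g b) ν t ∂(μ 0) := by
          rw [mgf, integral_pi_fin_succ, hmean]
          refine integral_congr_ae (.of_forall fun b => ?_)
          simp only [mgf]
          rw [← integral_const_mul]
          refine integral_congr_ae (.of_forall fun y => ?_)
          simp only [← Real.exp_add]
          ring_nf
      _ ≤ ∫ b, Real.exp (t * (g b - ∫ b, g b ∂(μ 0)))
            * Real.exp (((∑ i : Fin n, (‖d i.succ‖₊ / 2) ^ 2 : ℝ≥0) : ℝ) * t ^ 2 / 2) ∂(μ 0) :=
          integral_mono .of_finite .of_finite fun b =>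
            mul_le_mul_of_nonneg_left (hinner b) (Real.exp_pos _).le
      _ = mgf (fun b => g b - ∫ b, g b ∂(μ 0)) (μ 0) t
            * Real.exp (((∑ i : Fin n, (‖d i.succ‖₊ / 2) ^ 2 : ℝ≥0) : ℝ) * t ^ 2 / 2) := by
          rw [integral_mul_const, mgf]
      _ ≤ _ := by
          refine (mul_le_mul_of_nonneg_right (hoeffding.mgf_le t) (Real.exp_pos _).le).trans_eq ?_
          rw [← Real.exp_add, Fin.sum_univ_succ, NNReal.coe_add]
          ring_nf

/-- Independent centred Hilbert space valued variables bounded in norm by `r i` have a sum whose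
second moment is at most `∑ i, r i ^ 2`. -/
theorem integral_norm_sum_sq_le {E : Type*} [NormedAddCommGroup E] [InnerProductSpace ℝ E]
    [CompleteSpace E] {n : ℕ} (μ : Fin n → Measure α) [∀ i, IsProbabilityMeasure (μ i)]
    (Z : Fin n → α → E) (hZ : ∀ i, ∫ a, Z i a ∂(μ i) = 0) (r : Fin n → ℝ)
    (hr : ∀ i a, ‖Z i a‖ ≤ r i) :
    ∫ y, ‖∑ i, Z i (y i)‖ ^ 2 ∂(Measure.pi μ) ≤ ∑ i, r i ^ 2 := by
  induction n with
  | zero => simp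
  | succ n ih =>
    -- After the swap the first coordinate is integrated with the others fixed, so the cross term
    -- vanishes by centring.
    rw [integral_pi_fin_succ, integral_integral_swap .of_finite, Fin.sum_univ_succ]
    set ν : Measure (Fin n → α) := Measure.pi fun i => μ i.succ with hν
    have hstep : ∀ y : Fin n → α,
        ∫ b, ‖∑ i, Z i ((Fin.cons b y : Fin (n + 1) → α) i)‖ ^ 2 ∂(μ 0)
          ≤ r 0 ^ 2 + ‖∑ i : Fin n, Z i.succ (y i)‖ ^ 2 := by
      intro y
      set s : E := ∑ i : Fin n, Z i.succ (y i) with hs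
      have hcross : ∫ b, inner ℝ s (Z 0 b) ∂(μ 0) = 0 := by
        rw [integral_inner .of_finite, hZ, inner_zero_right]
      calc ∫ b, ‖∑ i, Z i ((Fin.cons b y : Fin (n + 1) → α) i)‖ ^ 2 ∂(μ 0)
          ≤ ∫ b, (r 0 ^ 2 + ‖s‖ ^ 2 + 2 * inner ℝ s (Z 0 b)) ∂(μ 0) := by
            refine integral_mono .of_finite .of_finite fun b => ?_
            simp only [Fin.sum_univ_succ, Fin.cons_zero, Fin.cons_succ, ← hs]
            rw [add_comm (Z 0 b), norm_add_sq_real]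
            have := pow_le_pow_left₀ (norm_nonneg _) (hr 0 b) 2
            linarith
        _ = r 0 ^ 2 + ‖s‖ ^ 2 := by
            rw [integral_add .of_finite .of_finite, integral_const_mul, hcross]
            simp
    refine (integral_mono .of_finite .of_finite hstep).trans ?_
    rw [integral_add .of_finite .of_finite, integral_const, probReal_univ, one_smul]
    gcongr
    exact ih _ _ (fun i => hZ i.succ) _ fun i => hr i.succ

/-- `Z a` is the average of `Z a - Z b` over `b`. Hence the diameters used for McDiarmid also serve
as radii in the second moment bound. -/
theorem norm_le_of_integral_eq_zero_of_norm_sub_le {E : Type*} [NormedAddCommGroup E]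
    [NormedSpace ℝ E] [CompleteSpace E] (μ : Measure α) [IsProbabilityMeasure μ] {Z : α → E}
    (hZ : ∫ a, Z a ∂μ = 0) {d : ℝ} (hd : ∀ a b, ‖Z a - Z b‖ ≤ d) (a : α) : ‖Z a‖ ≤ d := by
  have h : ∫ b, (Z a - Z b) ∂μ = Z a := by
    rw [integral_sub .of_finite .of_finite, hZ]
    simp
  rw [← h]
  simpa using norm_integral_le_of_norm_le_const (μ := μ) (.of_forall (hd a))

/-- Concentration of the norm of a sum of independent centred Hilbert space valued variables of
diameters at most `d i`. -/
theorem measure_pi_norm_sum_gt_le {E : Type*} [NormedAddCommGroup E] [InnerProductSpace ℝ E]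
    [CompleteSpace E] {n : ℕ} (μ : Fin n → Measure α) [∀ i, IsProbabilityMeasure (μ i)]
    (Z : Fin n → α → E) (hZ : ∀ i, ∫ a, Z i a ∂(μ i) = 0) (d : Fin n → ℝ)
    (hd : ∀ i a b, ‖Z i a - Z i b‖ ≤ d i) {δ : ℝ} (hδ : 0 < δ) (hδ1 : δ < 1) :
    (Measure.pi μ) {y | (1 + √(-Real.log δ / 2)) * √(∑ i, d i ^ 2) < ‖∑ i, Z i (y i)‖}
      ≤ ENNReal.ofReal δ := by
  have hr : ∀ i a, ‖Z i a‖ ≤ d i := fun i a =>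
    norm_le_of_integral_eq_zero_of_norm_sub_le (μ i) (hZ i) (hd i) a
  set D : ℝ := √(∑ i, d i ^ 2) with hD
  have hDsq : D ^ 2 = ∑ i, d i ^ 2 := Real.sq_sqrt (Finset.sum_nonneg fun i _ => sq_nonneg _)
  set f : (Fin n → α) → ℝ := fun y => ‖∑ i, Z i (y i)‖ with hf
  have hDnn : 0 ≤ D := Real.sqrt_nonneg _
  -- If `D = 0` the tail exponent would divide by zero, but then every `Z i` vanishes and the event
  -- is empty.
  rcases hDnn.eq_or_lt with hD0 | hD0
  · have hd0 : ∀ i, d i = 0 := by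
      rw [← hD0, zero_pow two_ne_zero, eq_comm,
        Finset.sum_eq_zero_iff_of_nonneg fun i _ => sq_nonneg _] at hDsq
      exact fun i => pow_eq_zero_iff two_ne_zero |>.mp (hDsq i (Finset.mem_univ i))
    have hZ0 : ∀ i a, Z i a = 0 := fun i a => norm_le_zero_iff.mp ((hr i a).trans_eq (hd0 i))
    simp [hZ0, ← hD0]
  have hmean : ∫ y, f y ∂(Measure.pi μ) ≤ D := by
    have hvar := variance_nonneg f (Measure.pi μ)
    rw [variance_eq_sub (MemLp.of_discrete)] at hvar
    have hsq := integral_norm_sum_sq_le μ Z hZ d hr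
    rw [← hDsq] at hsq
    have : (∫ y, f y ∂(Measure.pi μ)) ^ 2 ≤ D ^ 2 := by
      simp only [Pi.pow_apply] at hvar
      linarith
    exact le_of_sq_le_sq this hD0.le
  have hdiff : ∀ i y a, |f y - f (Function.update y i a)| ≤ d i := by
    intro i y a
    refine (abs_norm_sub_norm_le _ _).trans ?_
    rw [← Finset.sum_sub_distrib, Finset.sum_eq_single i]
    · simpa using hd i (y i) a
    · intro j _ hj
      simp [Function.update_of_ne hj]
    · simp
  have htail := (hasSubgaussianMGF_of_bounded_differences μ f d hdiff).measure_ge_le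
    (ε := √(-Real.log δ / 2) * D) (by positivity)
  have hc : ((∑ i, (‖d i‖₊ / 2) ^ 2 : ℝ≥0) : ℝ) = D ^ 2 / 4 := by
    rw [hDsq, Finset.sum_div]
    push_cast
    refine Finset.sum_congr rfl fun i _ => ?_
    rw [div_pow, Real.norm_eq_abs, sq_abs]
    norm_num
  have hlog : 0 ≤ -Real.log δ / 2 := by
    have := Real.log_neg hδ hδ1
    linarith
  -- The tail at `s * D` is `exp (-2 s²)`; `s = √(-log δ / 2)` makes it `δ`.
  have hexp : Real.exp (-(√(-Real.log δ / 2) * D) ^ 2 / (2 * (D ^ 2 / 4))) = δ := by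
    rw [mul_pow, Real.sq_sqrt hlog]
    have : -(-Real.log δ / 2 * D ^ 2) / (2 * (D ^ 2 / 4)) = Real.log δ := by
      have := hD0.ne'
      field_simp
      ring
    rw [this, Real.exp_log hδ]
  rw [hc, hexp] at htail
  refine (measure_mono fun y hy => ?_).trans (ENNReal.le_ofReal_iff_toReal_le
    (measure_ne_top _ _) hδ.le |>.mpr htail)
  simp only [Set.mem_ofPred_eq] at hy ⊢
  change _ < f y at hy
  linarith

end FiniteProduct

namespace SimpleComplex

/-! ### Weights against ideal coefficients. -/

section Deterministic

variable {𝒳 Θ : Type*} {n n' : ℕ}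

theorem abs_labelSign_mul (b : Bool) (t : ℝ) : |labelSign b * t| = |t| := by
  cases b <;> simp [labelSign]

theorem sum_ite_mem_eq (Do : Finset (Fin n)) (a b : ℝ) :
    ∑ i : Fin n, (if i ∈ Do then b else a) = n * a + Do.card * (b - a) := by
  have h : ∀ i : Fin n, (if i ∈ Do then b else a) = a + if i ∈ Do then b - a else 0 := by
    intro i
    split_ifs <;> ring
  simp [h, Finset.sum_add_distrib, mul_sub]

/-- On a discriminating feasible solution the weights are close to the ideal coefficients. -/
theorem sum_abs_weight_sub_idealCoeff_le {Ho : Type*} [NormedAddCommGroup Ho]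
    [InnerProductSpace ℝ Ho] {ψ : 𝒳 → Ho} {ε₁ ε₂ : ℝ} {Do : Finset (Fin n)} {x : Fin n → 𝒳}
    {y : Fin n → Bool} {wo : Ho} (hfeas : ∀ i, |inner ℝ wo (ψ (x i))| ≤ 1)
    (hdisc : Discriminates ψ ε₁ ε₂ Do x y wo) :
    ∑ i, |weight ψ x y wo i - idealCoeff Do i| ≤ n * ε₁ + Do.card * (1 - ε₁) := by
  rw [← sum_ite_mem_eq]
  refine Finset.sum_le_sum fun i _ => ?_
  unfold weight idealCoeff
  split_ifs with hi
  · have h1 := hfeas i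
    rw [real_inner_comm, ← abs_labelSign_mul (y i)] at h1
    rw [sub_zero, abs_of_nonneg (sub_nonneg.mpr ((le_abs_self _).trans h1))]
    linarith [hdisc.2.2 i hi]
  · rw [sub_sub_cancel_left, abs_neg, abs_labelSign_mul]
    exact hdisc.1 i hi

theorem abs_weightedRisk_sub_le (l : 𝒳 → Bool → Θ → ℝ) (β γ : Fin n → ℝ) (x : Fin n → 𝒳)
    (y : Fin n → Bool) (θ : Θ) {K : ℝ} (hl : ∀ x y, |l x y θ| ≤ K) :
    |weightedRisk l β x y θ - weightedRisk l γ x y θ| ≤ (n : ℝ)⁻¹ * ((∑ i, |β i - γ i|) * K) := by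
  rw [weightedRisk, weightedRisk, ← mul_sub, ← Finset.sum_sub_distrib, abs_mul,
    abs_of_nonneg (by positivity : (0 : ℝ) ≤ (n : ℝ)⁻¹)]
  gcongr
  refine (Finset.abs_sum_le_sum_abs _ _).trans ?_
  rw [Finset.sum_mul]
  refine Finset.sum_le_sum fun i _ => ?_
  rw [← sub_mul, abs_mul]
  exact mul_le_mul_of_nonneg_left (hl _ _) (abs_nonneg _)

end Deterministic

/-! ### Risk bound from the feature deviation, given the instances. -/

section Deviation

variable {𝒳 Θ : Type*} [MeasurableSpace 𝒳] {n n' : ℕ}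
  {E : Type*} [NormedAddCommGroup E] [InnerProductSpace ℝ E]

/-- Deviation of the ideally weighted mean of the features `Υ (xᵢ, yᵢ)` from its conditional
expectation given the instances. -/
noncomputable def featureDeviation (κ : Kernel 𝒳 Bool) (Υ : 𝒳 → Bool → E) (Do : Finset (Fin n))
    (x : Fin n → 𝒳) (y : Fin n → Bool) : E :=
  ∑ i, ((n : ℝ)⁻¹ * idealCoeff Do i) • (Υ (x i) (y i) - ∫ b, Υ (x i) b ∂(κ (x i)))

/-- The high probability bound on the norm of `featureDeviation`. -/
noncomputable def deviationBound (R δ : ℝ) (Do : Finset (Fin n)) : ℝ :=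
  (1 + √(-Real.log δ / 2)) * (2 * R / √(effSampleSize Do))

theorem riskBound_eq (C R B δ ε ε₁ : ℝ) (Do : Finset (Fin n)) :
    riskBound C R B δ ε ε₁ Do = C * deviationBound R δ Do + C * epsZero ε ε₁ B Do := by
  rw [riskBound, deviationBound]
  ring

/-- If all points are noisy, both sides are `0` by the convention on division, so no case split is
needed. -/
theorem sqrt_sum_sq_idealCoeff (Do : Finset (Fin n)) {R : ℝ} (hR : 0 ≤ R) :
    √(∑ i, ((n : ℝ)⁻¹ * idealCoeff Do i * (2 * R)) ^ 2) = 2 * R / √(effSampleSize Do) := by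
  have h : ∑ i, ((n : ℝ)⁻¹ * idealCoeff Do i * (2 * R)) ^ 2
      = (2 * R) ^ 2 / effSampleSize Do := by
    rw [effSampleSize, div_div_eq_mul_div, Finset.mul_sum, Finset.sum_div]
    refine Finset.sum_congr rfl fun i _ => ?_
    rw [div_eq_mul_inv, ← inv_pow]
    ring
  rw [h, Real.sqrt_div (sq_nonneg _), Real.sqrt_sq (by positivity)]

theorem measure_deviationBound_lt_le [CompleteSpace E] (κ : Kernel 𝒳 Bool) [IsMarkovKernel κ]
    (Υ : 𝒳 → Bool → E) {R : ℝ} (hΥ : ∀ x y, ‖Υ x y‖ ≤ R) (hR : 0 ≤ R) {δ : ℝ} (hδ : 0 < δ)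
    (hδ1 : δ < 1) (Do : Finset (Fin n)) (x : Fin n → 𝒳) :
    (Measure.pi fun i => κ (x i))
      {y | deviationBound R δ Do < ‖featureDeviation κ Υ Do x y‖} ≤ ENNReal.ofReal δ := by
  have hc : ∀ i, 0 ≤ (n : ℝ)⁻¹ * idealCoeff Do i := fun i => by
    unfold idealCoeff
    positivity
  have h := measure_pi_norm_sum_gt_le (fun i => κ (x i))
    (fun i b => ((n : ℝ)⁻¹ * idealCoeff Do i) • (Υ (x i) b - ∫ b, Υ (x i) b ∂(κ (x i))))
    (fun i => by
      rw [integral_smul, integral_sub .of_finite .of_finite, integral_const, probReal_univ,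
        one_smul, sub_self, smul_zero])
    (fun i => (n : ℝ)⁻¹ * idealCoeff Do i * (2 * R))
    (fun i a b => by
      rw [← smul_sub, sub_sub_sub_cancel_right, norm_smul, Real.norm_of_nonneg (hc i)]
      refine mul_le_mul_of_nonneg_left ((norm_sub_le _ _).trans ?_) (hc i)
      linarith [hΥ (x i) a, hΥ (x i) b]) hδ hδ1
  rwa [sqrt_sum_sq_idealCoeff Do hR] at h

theorem expectedRisk_eq (κ : Kernel 𝒳 Bool) [IsMarkovKernel κ] (l : 𝒳 → Bool → Θ → ℝ)
    (x' : Fin n' → 𝒳) (θ : Θ) :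
    expectedRisk κ l x' θ = (n' : ℝ)⁻¹ * ∑ j, ∫ b, l (x' j) b θ ∂(κ (x' j)) := by
  rw [expectedRisk, integral_const_mul, integral_finsetSum _ fun j _ => .of_finite]
  congr 1
  refine Finset.sum_congr rfl fun j _ => ?_
  exact integral_comp_eval (μ := fun j => κ (x' j)) (f := fun b => l (x' j) b θ)
    Measurable.of_discrete.aestronglyMeasurable

variable {H Ho F : Type*}
  [NormedAddCommGroup H] [InnerProductSpace ℝ H]
  [NormedAddCommGroup Ho] [InnerProductSpace ℝ Ho]
  [NormedAddCommGroup F] [InnerProductSpace ℝ F]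

/-- The risk with ideal coefficients is close to the expected risk on the test instances. -/
theorem abs_weightedRisk_idealCoeff_sub_expectedRisk_le [CompleteSpace E] (κ : Kernel 𝒳 Bool)
    [IsMarkovKernel κ] {l : 𝒳 → Bool → Θ → ℝ} {C : ℝ} {Υ : 𝒳 → Bool → E} {Λ : Θ → E}
    (hΛ : ∀ θ, ‖Λ θ‖ ≤ C) (hl : ∀ x y θ, l x y θ = inner ℝ (Υ x y) (Λ θ))
    {Φ : 𝒳 → F} {Ξ : Θ → F} (hΞ : ∀ θ, ‖Ξ θ‖ ≤ C)
    (hΦ : ∀ x θ, ∫ y, l x y θ ∂(κ x) = inner ℝ (Φ x) (Ξ θ))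
    (Do : Finset (Fin n)) (x : Fin n → 𝒳) (y : Fin n → Bool) (x' : Fin n' → 𝒳) (θ : Θ) :
    |weightedRisk l (idealCoeff Do) x y θ - expectedRisk κ l x' θ|
      ≤ C * ‖featureDeviation κ Υ Do x y‖ + C * meanDiscrepancy Φ Do x x' := by
  -- Both pairings equal the conditional expected loss; this links the features `Υ` to `Φ`.
  have hmean : ∀ x, inner ℝ (∫ b, Υ x b ∂(κ x)) (Λ θ) = inner ℝ (Φ x) (Ξ θ) := by
    intro x
    rw [← hΦ, real_inner_comm, ← integral_inner .of_finite]
    simp only [hl, real_inner_comm]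
  have hsplit : weightedRisk l (idealCoeff Do) x y θ - expectedRisk κ l x' θ
      = inner ℝ (featureDeviation κ Υ Do x y) (Λ θ)
        + inner ℝ ((n : ℝ)⁻¹ • ∑ i, idealCoeff Do i • Φ (x i)
          - (n' : ℝ)⁻¹ • ∑ j, Φ (x' j)) (Ξ θ) := by
    rw [expectedRisk_eq, weightedRisk, featureDeviation]
    simp only [hΦ]
    simp only [hl, sum_inner, inner_sub_left, real_inner_smul_left, hmean, Finset.mul_sum,
      Finset.sum_sub_distrib, mul_sub, mul_assoc]
    ring
  have hdev := abs_real_inner_le_norm (featureDeviation κ Υ Do x y) (Λ θ)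
  have hdis := abs_real_inner_le_norm ((n : ℝ)⁻¹ • ∑ i, idealCoeff Do i • Φ (x i)
          - (n' : ℝ)⁻¹ • ∑ j, Φ (x' j)) (Ξ θ)
  rw [hsplit, meanDiscrepancy, mul_comm C, mul_comm C]
  exact (abs_add_le _ _).trans (add_le_add
    (hdev.trans (mul_le_mul_of_nonneg_left (hΛ θ) (norm_nonneg _)))
    (hdis.trans (mul_le_mul_of_nonneg_left (hΞ θ) (norm_nonneg _))))

theorem boundHolds_of_norm_featureDeviation_le [CompleteSpace E] (φ : 𝒳 → H) (ψ : 𝒳 → Ho)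
    (lam lamo : ℝ) (κ : Kernel 𝒳 Bool) [IsMarkovKernel κ] {l : 𝒳 → Bool → Θ → ℝ} {C R B : ℝ}
    {Υ : 𝒳 → Bool → E} {Λ : Θ → E}
    (hΛ : ∀ θ, ‖Λ θ‖ ≤ C) (hl : ∀ x y θ, l x y θ = inner ℝ (Υ x y) (Λ θ))
    (hB : ∀ x y θ, |l x y θ| ≤ C * B)
    {Φ : 𝒳 → F} {Ξ : Θ → F} (hΞ : ∀ θ, ‖Ξ θ‖ ≤ C)
    (hΦ : ∀ x θ, ∫ y, l x y θ ∂(κ x) = inner ℝ (Φ x) (Ξ θ)) (hn : 0 < n)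
    {ε ε₁ ε₂ δ : ℝ} {Do : Finset (Fin n)} {x : Fin n → 𝒳} {y : Fin n → Bool} {x' : Fin n' → 𝒳}
    (hdisc : meanDiscrepancy Φ Do x x' ≤ ε)
    (hdev : ‖featureDeviation κ Υ Do x y‖ ≤ deviationBound R δ Do) :
    BoundHolds κ l φ ψ lam lamo ε₁ ε₂ C R B δ ε Do x y x' := by
  intro w wo hopt hd θ
  have hn0 : (n : ℝ) ≠ 0 := by positivity
  have hC : 0 ≤ C := (norm_nonneg _).trans (hΛ θ)
  have hCB : 0 ≤ C * B := (abs_nonneg _).trans (hB (x ⟨0, hn⟩) true θ)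
  have hweight := abs_weightedRisk_sub_le l (weight ψ x y wo) (idealCoeff Do) x y θ
    fun x y => hB x y θ
  have hideal := abs_weightedRisk_idealCoeff_sub_expectedRisk_le κ hΛ hl hΞ hΦ Do x y x' θ
  have hsum := sum_abs_weight_sub_idealCoeff_le hopt.1.2 hd
  have hbound : (n : ℝ)⁻¹ * ((∑ i, |weight ψ x y wo i - idealCoeff Do i|) * (C * B))
      ≤ (n : ℝ)⁻¹ * ((n * ε₁ + Do.card * (1 - ε₁)) * (C * B)) := by gcongr
  have heps : C * epsZero ε ε₁ B Do
      = C * ε + (n : ℝ)⁻¹ * ((n * ε₁ + Do.card * (1 - ε₁)) * (C * B)) := by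
    rw [epsZero, Finset.sum_const, Finset.card_univ, Fintype.card_fin, nsmul_eq_mul]
    field_simp
  rw [riskBound_eq, heps]
  have h1 := mul_le_mul_of_nonneg_left hdev hC
  have h2 := mul_le_mul_of_nonneg_left hdisc hC
  have h3 := abs_sub_le (weightedRisk l (weight ψ x y wo) x y θ)
    (weightedRisk l (idealCoeff Do) x y θ) (expectedRisk κ l x' θ)
  linarith

end Deviation

/-! ### From conditional to joint probability. -/

section JointLaw

variable {𝒳 : Type*} [MeasurableSpace 𝒳]

/-- Randomness of the label is moved into an independent source, which turns the disintegrated law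
into an image of a product measure. -/
theorem compProd_eq_map_prod_of_map_eq {β γ : Type*} [MeasurableSpace β] [MeasurableSpace γ]
    (μ : Measure 𝒳) [SFinite μ] (κ : Kernel 𝒳 β) [IsSFiniteKernel κ] (ρ : Measure γ) [SFinite ρ]
    {f : 𝒳 → γ → β} (hf : Measurable (Function.uncurry f)) (hfκ : ∀ x, ρ.map (f x) = κ x) :
    μ ⊗ₘ κ = (μ.prod ρ).map fun p => (p.1, f p.1 p.2) := by
  have hg : Measurable fun p : 𝒳 × γ => (p.1, f p.1 p.2) := measurable_fst.prodMk hf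
  ext s hs
  rw [Measure.compProd_apply hs, Measure.map_apply hg hs, Measure.prod_apply (hg hs)]
  refine lintegral_congr fun x => ?_
  rw [← hfκ, Measure.map_apply hf.of_uncurry_left (measurable_prodMk_left hs)]
  rfl

/-- The label of a noisy point has the same conditional law as that of a clean point. -/
theorem smul_eq_smul_compProd_of_contaminatedLaw (P N : Measure (𝒳 × Bool))
    [IsProbabilityMeasure P] [IsProbabilityMeasure N] (η : ℝ≥0) (κ : Kernel 𝒳 Bool)
    [IsMarkovKernel κ] (hP : P = P.fst ⊗ₘ κ)
    (hQ : contaminatedLaw η P N = (contaminatedLaw η P N).fst ⊗ₘ κ) :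
    η • N = η • (N.fst ⊗ₘ κ) := by
  have hfst : (contaminatedLaw η P N).fst = (1 - η) • P.fst + η • N.fst := by
    rw [contaminatedLaw, Measure.fst, Measure.map_add _ _ measurable_fst, Measure.map_smul,
      Measure.map_smul]
    rfl
  have hsmul : ∀ (c : ℝ≥0) (μ : Measure 𝒳) [SFinite μ], (c • μ) ⊗ₘ κ = c • (μ ⊗ₘ κ) :=
    fun c μ _ => Measure.compProd_smul_left (c : ℝ≥0∞)
  rw [hfst, Measure.compProd_add_left, hsmul, hsmul, ← hP, contaminatedLaw] at hQ
  ext s hs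
  have h := congrArg (fun μ : Measure (𝒳 × Bool) => μ s) hQ
  simp only [Measure.add_apply] at h
  -- The clean part has finite mass and cancels. The factor `η` stays, because `η = 0` leaves `N`
  -- unconstrained.
  exact (ENNReal.add_right_inj (measure_ne_top ((1 - η) • P) s)).mp h

/-- The law of a flag and an instance under `flaggedLaw`. -/
noncomputable def flaggedInstanceLaw (η : ℝ≥0) (P N : Measure (𝒳 × Bool)) :
    Measure (Bool × 𝒳) :=
  (1 - η) • P.fst.map (Prod.mk false) + η • N.fst.map (Prod.mk true)

theorem isProbabilityMeasure_flaggedInstanceLaw (P N : Measure (𝒳 × Bool))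
    [IsProbabilityMeasure P] [IsProbabilityMeasure N] {η : ℝ≥0} (hη : η ≤ 1) :
    IsProbabilityMeasure (flaggedInstanceLaw η P N) := by
  have hmap : ∀ (b : Bool) (μ : Measure 𝒳) [IsProbabilityMeasure μ],
      (μ.map (Prod.mk b)) Set.univ = 1 := fun b μ _ => by
    rw [Measure.map_apply measurable_prodMk_left .univ]
    simp
  refine ⟨?_⟩
  rw [flaggedInstanceLaw, Measure.add_apply, Measure.smul_apply, Measure.smul_apply, hmap, hmap,
    ENNReal.smul_def, ENNReal.smul_def, smul_eq_mul, smul_eq_mul, mul_one, mul_one]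
  exact_mod_cast tsub_add_cancel_of_le hη

/-- A flagged draw is obtained by drawing the flag and the instance, and then the label from `κ`
by means of an independent source `ρ`. -/
theorem flaggedLaw_eq_map_prod (P N : Measure (𝒳 × Bool)) [IsProbabilityMeasure P]
    [IsProbabilityMeasure N] (η : ℝ≥0) (κ : Kernel 𝒳 Bool) [IsMarkovKernel κ]
    (hP : P = P.fst ⊗ₘ κ) (hN : η • N = η • (N.fst ⊗ₘ κ)) {γ : Type*} [MeasurableSpace γ]
    (ρ : Measure γ) [SFinite ρ] {f : 𝒳 → γ → Bool} (hf : Measurable (Function.uncurry f))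
    (hfκ : ∀ x, ρ.map (f x) = κ x) :
    flaggedLaw η P N = ((flaggedInstanceLaw η P N).prod ρ).map
      fun p => (p.1.1, (p.1.2, f p.1.2 p.2)) := by
  have hG : Measurable fun p : (Bool × 𝒳) × γ => (p.1.1, (p.1.2, f p.1.2 p.2)) := by
    have : Measurable fun p : (Bool × 𝒳) × γ => f p.1.2 p.2 :=
      hf.comp ((measurable_snd.comp measurable_fst).prodMk measurable_snd)
    fun_prop
  have hg : Measurable fun p : 𝒳 × γ => (p.1, f p.1 p.2) := measurable_fst.prodMk hf
  have hcomp : ∀ (b : Bool) (μ : Measure 𝒳) [SFinite μ],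
      (((μ.map (Prod.mk b)).prod ρ).map fun p => (p.1.1, (p.1.2, f p.1.2 p.2)))
        = (μ ⊗ₘ κ).map (Prod.mk b) := by
    intro b μ _
    have h := Measure.map_prod_map μ ρ (measurable_prodMk_left (x := b)) measurable_id
    rw [Measure.map_id] at h
    rw [h, Measure.map_map hG (measurable_prodMk_left.prodMap measurable_id),
      compProd_eq_map_prod_of_map_eq μ κ ρ hf hfκ, Measure.map_map measurable_prodMk_left hg]
    rfl
  have hsmul : ∀ (c : ℝ≥0) (μ : Measure (Bool × 𝒳)) [SFinite μ],
      (c • μ).prod ρ = c • μ.prod ρ := fun c μ _ => Measure.prod_smul_left (c : ℝ≥0∞)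
  rw [flaggedInstanceLaw, Measure.add_prod, hsmul, hsmul, Measure.map_add _ _ hG,
    Measure.map_smul, Measure.map_smul, hcomp, hcomp, ← hP, ← Measure.map_smul (c := η), ← hN,
    Measure.map_smul, flaggedLaw]

/-- A bound on the conditional probability of an event given the flags and the instances is a
bound on its probability. -/
theorem measure_pi_flaggedLaw_le (P N : Measure (𝒳 × Bool)) [IsProbabilityMeasure P]
    [IsProbabilityMeasure N] {η : ℝ≥0} (hη : η ≤ 1) (κ : Kernel 𝒳 Bool) [IsMarkovKernel κ]
    (hP : P = P.fst ⊗ₘ κ) (hN : η • N = η • (N.fst ⊗ₘ κ)) {n : ℕ}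
    {S : Set (Fin n → Bool × (𝒳 × Bool))} (hS : MeasurableSet S) {c : ℝ≥0∞}
    (hc : ∀ z : Fin n → Bool × 𝒳,
      (Measure.pi fun i => κ (z i).2) {y | (fun i => ((z i).1, ((z i).2, y i))) ∈ S} ≤ c) :
    (Measure.pi fun _ : Fin n => flaggedLaw η P N) S ≤ c := by
  obtain ⟨f, hf, hfκ⟩ := κ.exists_measurable_map_eq_unitInterval
  have := isProbabilityMeasure_flaggedInstanceLaw P N hη
  set ν := flaggedInstanceLaw η P N with hν
  set ρ : Measure unitInterval := volume with hρ
  set G : (Bool × 𝒳) × unitInterval → Bool × (𝒳 × Bool) :=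
    fun p => (p.1.1, (p.1.2, f p.1.2 p.2)) with hGdef
  have hG : Measurable G := by
    have : Measurable fun p : (Bool × 𝒳) × unitInterval => f p.1.2 p.2 :=
      hf.comp ((measurable_snd.comp measurable_fst).prodMk measurable_snd)
    fun_prop
  have hlaw : flaggedLaw η P N = (ν.prod ρ).map G :=
    flaggedLaw_eq_map_prod P N η κ hP hN ρ hf hfκ
  have hprob : IsProbabilityMeasure ((ν.prod ρ).map G) :=
    Measure.isProbabilityMeasure_map hG.aemeasurable
  have hGn : Measurable fun (w : Fin n → (Bool × 𝒳) × unitInterval) i => G (w i) :=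
    measurable_pi_lambda _ fun i => hG.comp (measurable_pi_apply i)
  -- Regroups the `n` pairs so that all flags and instances are separated from all label sources,
  -- ready for Fubini.
  have hswap := (measurePreserving_arrowProdEquivProdArrow (Bool × 𝒳) unitInterval (Fin n)
    (fun _ => ν) (fun _ => ρ)).symm
  have hT : MeasurableSet {p : (Fin n → Bool × 𝒳) × (Fin n → unitInterval) |
      (fun i => G (p.1 i, p.2 i)) ∈ S} :=
    (hGn.comp (MeasurableEquiv.arrowProdEquivProdArrow (Bool × 𝒳) unitInterval
      (Fin n)).symm.measurable) hS
  have hpi : (Measure.pi fun _ : Fin n => flaggedLaw η P N) S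
      = ((Measure.pi fun _ : Fin n => ν).prod (Measure.pi fun _ : Fin n => ρ))
        {p | (fun i => G (p.1 i, p.2 i)) ∈ S} := by
    simp only [hlaw]
    rw [← Measure.pi_map_pi (f := fun _ => G) (fun _ => hG.aemeasurable),
      Measure.map_apply hGn hS, ← hswap.map_eq, Measure.map_apply hswap.measurable (hGn hS)]
    rfl
  rw [hpi, Measure.prod_apply hT]
  refine (lintegral_mono (g := fun _ => c) fun z => ?_).trans_eq (by simp)
  refine le_of_eq_of_le ?_ (hc z)
  have hfz : ∀ i, Measurable (f (z i).2) := fun i => hf.of_uncurry_left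
  have hmap : (Measure.pi fun i => κ (z i).2)
      = (Measure.pi fun _ : Fin n => ρ).map fun u i => f (z i).2 (u i) := by
    have hprob' : ∀ i, IsProbabilityMeasure (ρ.map (f (z i).2)) := fun i =>
      Measure.isProbabilityMeasure_map (hfz i).aemeasurable
    rw [Measure.pi_map_pi (f := fun i => f (z i).2) fun i => (hfz i).aemeasurable]
    simp only [hfκ]
  have hfzn : Measurable fun (u : Fin n → unitInterval) i => f (z i).2 (u i) :=
    measurable_pi_lambda _ fun i => (hfz i).comp (measurable_pi_apply i)
  rw [hmap, Measure.map_apply hfzn (Set.toFinite _).measurableSet]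
  rfl

end JointLaw

/-! ### Measurability of the deviation event. -/

section Measurability

variable {𝒳 : Type*} [MeasurableSpace 𝒳] {n : ℕ}
  {E : Type*} [NormedAddCommGroup E] [InnerProductSpace ℝ E]

theorem measurableSet_noisySet_eq (Do : Finset (Fin n)) :
    MeasurableSet {s : Fin n → Bool × (𝒳 × Bool) | noisySet s = Do} := by
  have h : {s : Fin n → Bool × (𝒳 × Bool) | noisySet s = Do}
      = ⋂ i, {s | (s i).1 = decide (i ∈ Do)} := by
    ext s
    rw [Set.mem_ofPred_eq, Set.mem_iInter, Finset.ext_iff]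
    refine forall_congr' fun i => ?_
    by_cases hi : i ∈ Do <;> simp [noisySet, hi]
  rw [h]
  exact .iInter fun i => (measurable_fst.comp (measurable_pi_apply i)) (measurableSet_singleton _)

theorem stronglyMeasurable_uncurry_bool {E : Type*} [TopologicalSpace E] {Υ : 𝒳 → Bool → E}
    (hΥ : ∀ y, StronglyMeasurable fun x => Υ x y) :
    StronglyMeasurable (Function.uncurry Υ) := by
  have h : Function.uncurry Υ = fun p => if p.2 = true then Υ p.1 true else Υ p.1 false := by
    ext ⟨x, b⟩
    cases b <;> rfl
  rw [h]
  exact .ite (measurable_snd (measurableSet_singleton true))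
    ((hΥ true).comp_measurable measurable_fst) ((hΥ false).comp_measurable measurable_fst)

theorem stronglyMeasurable_featureDeviation (κ : Kernel 𝒳 Bool) [IsMarkovKernel κ]
    {Υ : 𝒳 → Bool → E} (hΥ : ∀ y, StronglyMeasurable fun x => Υ x y) (Do : Finset (Fin n)) :
    StronglyMeasurable fun s : Fin n → Bool × (𝒳 × Bool) =>
      featureDeviation κ Υ Do (fun i => (s i).2.1) (fun i => (s i).2.2) := by
  unfold featureDeviation
  refine Finset.stronglyMeasurable_fun_sum _ fun i _ => StronglyMeasurable.const_smul ?_ _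
  have hjoint := stronglyMeasurable_uncurry_bool hΥ
  have hi : Measurable fun s : Fin n → Bool × (𝒳 × Bool) => (s i).2 := by fun_prop
  have hint : StronglyMeasurable fun x => ∫ b, Υ x b ∂(κ x) :=
    hjoint.integral_kernel_prod_right'
  exact (hjoint.comp_measurable hi).sub (hint.comp_measurable (measurable_fst.comp hi))

/-- Fubini is applied to this event instead of the failure of `BoundHolds`, which quantifies over
all solutions and all `θ` and need not be measurable. -/
theorem measurableSet_deviationBound_lt (κ : Kernel 𝒳 Bool) [IsMarkovKernel κ]
    {Υ : 𝒳 → Bool → E} (hΥ : ∀ y, StronglyMeasurable fun x => Υ x y) (R δ : ℝ) :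
    MeasurableSet {s : Fin n → Bool × (𝒳 × Bool) | deviationBound R δ (noisySet s)
      < ‖featureDeviation κ Υ (noisySet s) (fun i => (s i).2.1) (fun i => (s i).2.2)‖} := by
  have h : {s : Fin n → Bool × (𝒳 × Bool) | deviationBound R δ (noisySet s)
      < ‖featureDeviation κ Υ (noisySet s) (fun i => (s i).2.1) (fun i => (s i).2.2)‖}
      = ⋃ Do : Finset (Fin n), {s | noisySet s = Do} ∩ {s | deviationBound R δ Do
        < ‖featureDeviation κ Υ Do (fun i => (s i).2.1) (fun i => (s i).2.2)‖} := by
    ext s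
    simp
  rw [h]
  exact .iUnion fun Do => (measurableSet_noisySet_eq Do).inter
    (measurableSet_lt measurable_const (stronglyMeasurable_featureDeviation κ hΥ Do).norm.measurable)

end Measurability

end SimpleComplex

theorem theorem5
    {𝒳 : Type*} [MeasurableSpace 𝒳]
    -- Hilbert spaces of the two classifiers, and their feature maps
    {H : Type*} [NormedAddCommGroup H] [InnerProductSpace ℝ H] [CompleteSpace H]
    {Ho : Type*} [NormedAddCommGroup Ho] [InnerProductSpace ℝ Ho] [CompleteSpace Ho]
    (φ : 𝒳 → H) (ψ : 𝒳 → Ho) (lam lamo : ℝ)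
    -- clean law `P`, contaminated law `Q`, common conditional law `κ` of the label
    (P N Q : Measure (𝒳 × Bool)) [IsProbabilityMeasure P] [IsProbabilityMeasure N]
    (η : ℝ≥0) (hη : η ≤ 1) (hQ : Q = contaminatedLaw η P N)
    (κ : Kernel 𝒳 Bool) [IsMarkovKernel κ]
    (hPκ : P = P.fst ⊗ₘ κ) (hQκ : Q = Q.fst ⊗ₘ κ)
    -- the loss class
    {Θ : Type*} (l : 𝒳 → Bool → Θ → ℝ) (C R B : ℝ)
    {E : Type*} [NormedAddCommGroup E] [InnerProductSpace ℝ E] [CompleteSpace E]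
    (Υ : 𝒳 → Bool → E) (hΥmeas : ∀ y, StronglyMeasurable fun x => Υ x y)
    (hΥ : ∀ x y, ‖Υ x y‖ ≤ R)
    (Λ : Θ → E) (hΛ : ∀ θ, ‖Λ θ‖ ≤ C) (hl : ∀ x y θ, l x y θ = inner ℝ (Υ x y) (Λ θ))
    (hB : ∀ x y θ, |l x y θ| ≤ C * B)
    {F : Type*} [NormedAddCommGroup F] [InnerProductSpace ℝ F] [CompleteSpace F]
    (Φ : 𝒳 → F) (Ξ : Θ → F) (hΞ : ∀ θ, ‖Ξ θ‖ ≤ C)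
    (hΦ : ∀ x θ, ∫ y, l x y θ ∂(κ x) = inner ℝ (Φ x) (Ξ θ))
    (n n' : ℕ) (hn : 0 < n) (hn' : 0 < n')
    (ε ε₁ ε₂ δ : ℝ) (hδ : 0 < δ) (hδ1 : δ < 1) :
    -- conditionally on the instances
    (∀ (Do : Finset (Fin n)) (x : Fin n → 𝒳) (x' : Fin n' → 𝒳), meanDiscrepancy Φ Do x x' ≤ ε →
      (Measure.pi fun i => κ (x i))
        {y : Fin n → Bool |
          ¬ BoundHolds κ l φ ψ lam lamo ε₁ ε₂ C R B δ ε Do x y x'} ≤ ENNReal.ofReal δ) ∧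
    -- over the draw of the training sample from `Q` and of the test instances from `P`
    ((Measure.pi fun _ : Fin n => flaggedLaw η P N).prod (Measure.pi fun _ : Fin n' => P.fst))
        {ω | meanDiscrepancy Φ (noisySet ω.1) (fun i => (ω.1 i).2.1) ω.2 ≤ ε ∧
          ¬ BoundHolds κ l φ ψ lam lamo ε₁ ε₂ C R B δ ε (noisySet ω.1)
            (fun i => (ω.1 i).2.1) (fun i => (ω.1 i).2.2) ω.2} ≤ ENNReal.ofReal δ := by
  
  have hN := smul_eq_smul_compProd_of_contaminatedLaw P N η κ hPκ (hQ ▸ hQκ)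
  -- A point of `𝒳` is needed to read `0 ≤ R` off the bound on `Υ`.
  obtain ⟨⟨x₀, y₀⟩⟩ := nonempty_of_isProbabilityMeasure P
  have hR : 0 ≤ R := (norm_nonneg _).trans (hΥ x₀ y₀)
  have hbound : ∀ (Do : Finset (Fin n)) (x : Fin n → 𝒳) (y : Fin n → Bool) (x' : Fin n' → 𝒳),
      meanDiscrepancy Φ Do x x' ≤ ε →
      ¬ BoundHolds κ l φ ψ lam lamo ε₁ ε₂ C R B δ ε Do x y x' →
      deviationBound R δ Do < ‖featureDeviation κ Υ Do x y‖ := by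
    intro Do x y x' hdisc hy
    by_contra h
    exact hy (boundHolds_of_norm_featureDeviation_le φ ψ lam lamo κ hΛ hl hB hΞ hΦ hn hdisc
      (not_lt.mp h))
  have hcond := fun (Do : Finset (Fin n)) (x : Fin n → 𝒳) =>
    measure_deviationBound_lt_le κ Υ hΥ hR hδ hδ1 Do x
  refine ⟨fun Do x x' hdisc =>
    (measure_mono fun y hy => hbound Do x y x' hdisc hy).trans (hcond Do x), ?_⟩
  have : IsProbabilityMeasure P.fst := inferInstance
  set A : Set (Fin n → Bool × (𝒳 × Bool)) := {s | deviationBound R δ (noisySet s)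
    < ‖featureDeviation κ Υ (noisySet s) (fun i => (s i).2.1) (fun i => (s i).2.2)‖} with hA
  have hjoint : (Measure.pi fun _ : Fin n => flaggedLaw η P N) A ≤ ENNReal.ofReal δ := by
    refine measure_pi_flaggedLaw_le P N hη κ hPκ hN
      (measurableSet_deviationBound_lt κ hΥmeas R δ) fun z => ?_
    -- The noisy set depends on the flags alone, so it is constant once `z` is fixed.
    exact hcond (Finset.univ.filter fun i => (z i).1 = true) fun i => (z i).2
  -- `A` does not involve the test instances, and monotonicity of the outer measure asks no
  -- measurability of the failure event.
  calc _ ≤ ((Measure.pi fun _ : Fin n => flaggedLaw η P N).prod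
        (Measure.pi fun _ : Fin n' => P.fst)) (A ×ˢ Set.univ) :=
        measure_mono fun ω hω => ⟨hbound _ _ _ _ hω.1 hω.2, Set.mem_univ _⟩
    _ ≤ ENNReal.ofReal δ := by
        rw [Measure.prod_prod, measure_univ, mul_one]
        exact hjoint
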